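/- Let $d\in\mathbb{N}$ and let $\mathcal{P}_2(\mathbb{R}^d)$ be the set of Borel probability measures on $\mathbb{R}^d$ with finite second moment, with the 2-Wasserstein distance $\mathrm{W}_2(\mu,\nu)=\big(\inf_{\gamma\in\Pi(\mu,\nu)}\int\|x-y\|_2^2\,\mathrm{d}\gamma(x,y)\big)^{1/2}$, where $\Pi(\mu,\nu)$ is the set of couplings of $\mu$ and $\nu$. A geodesic ray is a family $(\mu_t)_{t\ge 0}$ in $\mathcal{P}_2(\mathbb{R}^d)$ with $\mathrm{W}_2(\mu_t,\mu_s)=|t-s|\,\mathrm{W}_2(\mu_0,\mu_1)$ for all $s,t\ge 0$. Its Busemann function is $B^\mu(\nu)=\lim_{t\to\infty}\big(\mathrm{W}_2(\mu_t,\nu)-t\,\mathrm{W}_2(\mu_0,\mu_1)\big)$. Let $m_0,m_1,m\in\mathbb{R}^d$ and let $\Sigma_0,\Sigma_1,\Sigma$ be symmetric positive definite real $d\times d$ matrices. Let $(\mu_t)_{t\ge 0}$ be a geodesic ray in $\mathcal{P}_2(\mathbb{R}^d)$ with $\mu_0=\mathcal{N}(m_0,\Sigma_0)$, $\mu_1=\mathcal{N}(m_1,\Sigma_1)$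 and $\mathrm{W}_2(\mu_0,\mu_1)=1$, and let $A=\Sigma_0^{-\frac12}\big(\Sigma_0^{\frac12}\Sigma_1\Sigma_0^{\frac12}\big)^{\frac12}\Sigma_0^{-\frac12}$. Then for $\nu=\mathcal{N}(m,\Sigma)$ the limit defining $B^\mu(\nu)$ exists, and $$B^\mu(\nu)=-\langle m_1-m_0,\,m-m_0\rangle+\mathrm{Tr}\big(\Sigma_0(A-I_d)\big)-\mathrm{Tr}\Big(\big(\Sigma^{\frac12}(\Sigma_0-\Sigma_0A-A\Sigma_0+\Sigma_1)\Sigma^{\frac12}\big)^{\frac12}\Big).$$ -/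

import Mathlib

open MeasureTheory ProbabilityTheory Filter Topology
open scoped ENNReal RealInnerProductSpace

namespace BuresWasserstein

/-- `𝒫₂(ℝᵈ)`: the Borel probability measures on `ℝᵈ` with finite second moment. -/
def P2 (d : ℕ) : Set (Measure (EuclideanSpace ℝ (Fin d))) :=
  {μ | IsProbabilityMeasure μ ∧ ∫⁻ x, ‖x‖ₑ ^ 2 ∂μ < ∞}

/-- `Π(μ, ν)`: the couplings of `μ` and `ν`, i.e. the measures on the product space with first
marginal `μ` and second marginal `ν`. -/
def Couplings {d : ℕ} (μ ν : Measure (EuclideanSpace ℝ (Fin d))) :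
    Set (Measure (EuclideanSpace ℝ (Fin d) × EuclideanSpace ℝ (Fin d))) :=
  {γ | γ.map Prod.fst = μ ∧ γ.map Prod.snd = ν}

/-- The 2-Wasserstein distance: the square root of the infimum of `∫ ‖x - y‖² dγ(x, y)` over all
couplings `γ` of `μ` and `ν`. The infimum is taken in `[0, ∞]`; it is finite on `𝒫₂(ℝᵈ)`. -/
noncomputable def W2 {d : ℕ} (μ ν : Measure (EuclideanSpace ℝ (Fin d))) : ℝ :=
  √(⨅ γ ∈ Couplings μ ν, ∫⁻ p, ‖p.1 - p.2‖ₑ ^ 2 ∂γ).toReal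

/-- `(μ_t)_{t ≥ 0}` is a geodesic ray in `(𝒫₂(ℝᵈ), W₂)`. Only the values at `t ≥ 0` matter. -/
structure IsGeodesicRay {d : ℕ} (μ : ℝ → Measure (EuclideanSpace ℝ (Fin d))) : Prop where
  mem_P2 : ∀ t, 0 ≤ t → μ t ∈ P2 d
  W2_eq : ∀ s t, 0 ≤ s → 0 ≤ t → W2 (μ t) (μ s) = |t - s| * W2 (μ 0) (μ 1)

/-- The Busemann function `B^μ(ν) = lim_{t → ∞} (W₂(μ_t, ν) - κ t)` of the curve `(μ_t)`, with
`κ = W₂(μ_0, μ_1)`, exists at `ν` and has the value `b`. -/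
def HasBusemannValue {d : ℕ} (μ : ℝ → Measure (EuclideanSpace ℝ (Fin d)))
    (ν : Measure (EuclideanSpace ℝ (Fin d))) (b : ℝ) : Prop :=
  Tendsto (fun t : ℝ => W2 (μ t) ν - W2 (μ 0) (μ 1) * t) atTop (𝓝 b)

section

open scoped MatrixOrder

/-- The positive semidefinite square root `S^{1/2}` of a positive semidefinite real matrix `S`. -/
noncomputable def msqrt {d : ℕ} (S : Matrix (Fin d) (Fin d) ℝ) : Matrix (Fin d) (Fin d) ℝ :=
  CFC.sqrt S

end

/-- The linear part of the optimal transport map between Gaussians with positive definite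
covariances `S₀` and `S₁`: the matrix `S₀^{-1/2} (S₀^{1/2} S₁ S₀^{1/2})^{1/2} S₀^{-1/2}`. -/
noncomputable def buresOT {d : ℕ} (S₀ S₁ : Matrix (Fin d) (Fin d) ℝ) :
    Matrix (Fin d) (Fin d) ℝ :=
  (msqrt S₀)⁻¹ * msqrt (msqrt S₀ * S₁ * msqrt S₀) * (msqrt S₀)⁻¹

end BuresWasserstein

open BuresWasserstein

/-! Everything rests on the closed form of `W2` between Gaussians. A positive definite affine map is
optimal between a Gaussian and its image, as quadratic Kantorovich potentials show (`W2_sq_affine`);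
taking A = `buresOT S₀ S₁` as linear part gives `W2_sq_multivariateGaussian`.

The ray is only a metric geodesic, so its Gaussianity has to be forced. For t > 1, a near-optimal
coupling of `μ t` with `μ 1`, followed by the optimal map from `μ 1` back to `μ 0`, must be nearly
straight, because `μ t` is at distance t from `μ 0` (`eq_map_extrapolation`). Hence `μ t` has mean
m₀ + t(m₁ - m₀) and covariance M S₀ M with M = 1 + t(A - 1). The value t of the distance to `μ 0`
also forces M to be positive (`posDef_displacement`).

The closed form now reads W2(μ t, ν)² = t² + 2t b(t) + D, the coefficient of t² being one by unit
speed, so the Busemann limit is lim b (`tendsto_sub_of_sq_eq`). The only varying term of b(t) is the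
trace of the square root of S^{1/2}(t⁻¹ + A - 1)S₀(t⁻¹ + A - 1)S^{1/2}, which converges by
continuity of the square root. Finally A S₀ A = S₁ turns (A - 1)S₀(A - 1) into S₀ - S₀A - AS₀ + S₁.
-/

namespace BuresWasserstein

open Matrix

/-! ### Square roots of positive semidefinite matrices. -/

section MatrixSquareRoot

open scoped MatrixOrder

variable {d : ℕ} {S S₀ S₁ K : Matrix (Fin d) (Fin d) ℝ}

lemma posSemidef_msqrt (S : Matrix (Fin d) (Fin d) ℝ) : (msqrt S).PosSemidef :=
  (CFC.sqrt_nonneg S).posSemidef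

lemma isHermitian_msqrt (S : Matrix (Fin d) (Fin d) ℝ) : (msqrt S)ᴴ = msqrt S :=
  (posSemidef_msqrt S).isHermitian

lemma msqrt_mul_msqrt (hS : S.PosSemidef) : msqrt S * msqrt S = S :=
  CFC.sqrt_mul_sqrt_self S hS.nonneg

lemma isUnit_msqrt (hS : S.PosDef) : IsUnit (msqrt S) :=
  hS.isStrictlyPositive.isUnit_cfcSqrt

/-- Continuity is needed on the whole closed cone: the limiting covariance is singular when A - 1
is. -/
lemma continuousOn_msqrt :
    ContinuousOn (msqrt : Matrix (Fin d) (Fin d) ℝ → Matrix (Fin d) (Fin d) ℝ)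
      {S | S.PosSemidef} := by
  open scoped Matrix.Norms.L2Operator in
  have h := CFC.continuousOn_sqrt (A := Matrix (Fin d) (Fin d) ℝ)
  simp only [Matrix.nonneg_iff_posSemidef] at h
  exact h

/-- The square root is homogeneous under squares of scalars. -/
lemma msqrt_sq_smul (hS : S.PosSemidef) {c : ℝ} (hc : 0 ≤ c) :
    msqrt (c ^ 2 • S) = c • msqrt S := by
  refine CFC.sqrt_unique ?_ ((posSemidef_msqrt S).smul hc).nonneg
  rw [smul_mul_smul_comm, msqrt_mul_msqrt hS, sq]

lemma posSemidef_msqrt_mul_mul_msqrt (hS₁ : S₁.PosSemidef) :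
    (msqrt S₀ * S₁ * msqrt S₀).PosSemidef := by
  have := hS₁.conjTranspose_mul_mul_same (msqrt S₀)
  rwa [isHermitian_msqrt] at this

/-- A Hermitian matrix whose absolute value has no larger trace is positive semidefinite. -/
lemma posSemidef_of_trace_msqrt_le (hK : K.IsHermitian)
    (h : (msqrt (K * K)).trace ≤ K.trace) : K.PosSemidef := by
  have habs : msqrt (K * K) = CFC.abs K := by
    rw [msqrt, CFC.abs, Matrix.star_eq_conjTranspose, hK.eq]
  -- |K| - K is twice the negative part of K; a positive semidefinite matrix with nonpositive trace
  -- vanishes.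
  have hsub : (CFC.abs K - K).PosSemidef := by
    rw [CFC.abs_sub_self K hK]
    exact (smul_nonneg (by norm_num) (CFC.negPart_nonneg K)).posSemidef
  have h0 : (CFC.abs K - K).trace = 0 := by
    refine le_antisymm ?_ hsub.trace_nonneg
    rw [Matrix.trace_sub, ← habs]
    linarith
  have := sub_eq_zero.1 (hsub.trace_eq_zero_iff.1 h0)
  rw [← this]
  exact (CFC.abs_nonneg K).posSemidef

end MatrixSquareRoot

/-! ### Algebra of the Bures transport matrix. -/

section OptimalTransportMatrix

variable {d : ℕ} {S₀ S₁ : Matrix (Fin d) (Fin d) ℝ}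

lemma isHermitian_inv_msqrt (S : Matrix (Fin d) (Fin d) ℝ) : ((msqrt S)⁻¹)ᴴ = (msqrt S)⁻¹ := by
  rw [conjTranspose_nonsing_inv, isHermitian_msqrt]

lemma posSemidef_buresOT (S₀ S₁ : Matrix (Fin d) (Fin d) ℝ) : (buresOT S₀ S₁).PosSemidef := by
  have := (posSemidef_msqrt (msqrt S₀ * S₁ * msqrt S₀)).conjTranspose_mul_mul_same (msqrt S₀)⁻¹
  rwa [isHermitian_inv_msqrt] at this

lemma transpose_buresOT (S₀ S₁ : Matrix (Fin d) (Fin d) ℝ) :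
    (buresOT S₀ S₁)ᵀ = buresOT S₀ S₁ :=
  (posSemidef_buresOT S₀ S₁).isHermitian

lemma msqrt_mul_inv (h₀ : S₀.PosDef) : msqrt S₀ * (msqrt S₀)⁻¹ = 1 :=
  mul_nonsing_inv _ ((isUnit_iff_isUnit_det _).1 (isUnit_msqrt h₀))

lemma inv_mul_msqrt (h₀ : S₀.PosDef) : (msqrt S₀)⁻¹ * msqrt S₀ = 1 :=
  nonsing_inv_mul _ ((isUnit_iff_isUnit_det _).1 (isUnit_msqrt h₀))

lemma posDef_buresOT (h₀ : S₀.PosDef) (h₁ : S₁.PosDef) : (buresOT S₀ S₁).PosDef := by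
  refine (posSemidef_buresOT S₀ S₁).posDef_iff_isUnit.2 ?_
  have hu := isUnit_msqrt h₀
  have hi : IsUnit (msqrt S₀)⁻¹ := by
    rw [isUnit_nonsing_inv_iff]; exact hu
  have hm : (msqrt S₀ * S₁ * msqrt S₀).PosDef :=
    (posSemidef_msqrt_mul_mul_msqrt h₁.posSemidef).posDef_iff_isUnit.2 ((hu.mul h₁.isUnit).mul hu)
  exact (hi.mul (isUnit_msqrt hm)).mul hi

/-- With R = S₀^{1/2} and Q² = R S₁ R, the inner factors cancel to R⁻¹Q²R⁻¹. This says that A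
transports covariance S₀ to S₁. -/
lemma buresOT_mul_mul_buresOT (h₀ : S₀.PosDef) (h₁ : S₁.PosSemidef) :
    buresOT S₀ S₁ * S₀ * buresOT S₀ S₁ = S₁ := by
  have hi := inv_mul_msqrt h₀
  have hi' := msqrt_mul_inv h₀
  have hs := msqrt_mul_msqrt h₀.posSemidef
  have hm := msqrt_mul_msqrt (posSemidef_msqrt_mul_mul_msqrt (S₀ := S₀) h₁)
  unfold buresOT
  set R := msqrt S₀
  set Q := msqrt (R * S₁ * R)
  calc R⁻¹ * Q * R⁻¹ * S₀ * (R⁻¹ * Q * R⁻¹)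
      = R⁻¹ * Q * (R⁻¹ * R) * (R * R⁻¹) * Q * R⁻¹ := by rw [← hs]; noncomm_ring
    _ = R⁻¹ * (Q * Q) * R⁻¹ := by rw [hi, hi']; noncomm_ring
    _ = (R⁻¹ * R) * S₁ * (R * R⁻¹) := by rw [hm]; noncomm_ring
    _ = S₁ := by rw [hi, hi']; simp

lemma trace_buresOT_mul (h₀ : S₀.PosDef) :
    (buresOT S₀ S₁ * S₀).trace = (msqrt (msqrt S₀ * S₁ * msqrt S₀)).trace := by
  have hi := inv_mul_msqrt h₀
  have hs := msqrt_mul_msqrt h₀.posSemidef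
  unfold buresOT
  set R := msqrt S₀
  set Q := msqrt (R * S₁ * R)
  calc (R⁻¹ * Q * R⁻¹ * S₀).trace = (R⁻¹ * Q * (R⁻¹ * R) * R).trace := by
        rw [← hs]; congr 1; noncomm_ring
    _ = (R⁻¹ * (Q * R)).trace := by rw [hi]; congr 1; noncomm_ring
    _ = Q.trace := by rw [trace_mul_comm, mul_assoc, msqrt_mul_inv h₀, mul_one]

/-- If a congruence by a Hermitian matrix `M` does no worse than the Bures map in correlation,
then `M` is positive semidefinite. -/
lemma posSemidef_of_trace_buresOT_le {M : Matrix (Fin d) (Fin d) ℝ} (h₀ : S₀.PosDef)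
    (hM : M.IsHermitian) (h : (buresOT S₀ (M * S₀ * M) * S₀).trace ≤ (M * S₀).trace) :
    M.PosSemidef := by
  rw [trace_buresOT_mul h₀] at h
  have hs := msqrt_mul_msqrt h₀.posSemidef
  have hi := inv_mul_msqrt h₀
  have hi' := msqrt_mul_inv h₀
  have hR := isHermitian_msqrt S₀
  have hRi := isHermitian_inv_msqrt S₀
  set R := msqrt S₀
  have hK : (R * M * R).PosSemidef := by
    refine posSemidef_of_trace_msqrt_le ?_ ?_
    · rw [Matrix.IsHermitian, conjTranspose_mul, conjTranspose_mul, hR, hM.eq, mul_assoc]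
    -- The square of R M R is the matrix under the root in the Bures trace, so the hypothesis
    -- compares the traces of |R M R| and R M R.
    · rw [show R * M * R * (R * M * R) = R * (M * S₀ * M) * R by rw [← hs]; noncomm_ring,
        trace_mul_cycle, hs, trace_mul_comm S₀]
      exact h
  have := hK.conjTranspose_mul_mul_same R⁻¹
  rwa [hRi, show R⁻¹ * (R * M * R) * R⁻¹ = (R⁻¹ * R) * M * (R * R⁻¹) by noncomm_ring, hi, hi',
    one_mul, mul_one] at this

end OptimalTransportMatrix

end BuresWasserstein

namespace BuresWasserstein

open Matrix

/-! ### Affine images and quadratic moments of Gaussian measures. -/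

section Gaussian

variable {d : ℕ} {m : EuclideanSpace ℝ (Fin d)} {S : Matrix (Fin d) (Fin d) ℝ}

/-- The affine map `x ↦ c + P (x - m)`. -/
noncomputable def affineMap (m c : EuclideanSpace ℝ (Fin d)) (P : Matrix (Fin d) (Fin d) ℝ)
    (x : EuclideanSpace ℝ (Fin d)) : EuclideanSpace ℝ (Fin d) :=
  c + toEuclideanCLM (𝕜 := ℝ) P (x - m)

@[fun_prop]
lemma continuous_affineMap (m c : EuclideanSpace ℝ (Fin d)) (P : Matrix (Fin d) (Fin d) ℝ) :
    Continuous (affineMap m c P) := by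
  unfold affineMap; fun_prop

@[fun_prop]
lemma measurable_affineMap (m c : EuclideanSpace ℝ (Fin d)) (P : Matrix (Fin d) (Fin d) ℝ) :
    Measurable (affineMap m c P) :=
  (continuous_affineMap m c P).measurable

lemma inner_toEuclideanCLM_left (P : Matrix (Fin d) (Fin d) ℝ) (x y : EuclideanSpace ℝ (Fin d)) :
    ⟪toEuclideanCLM (𝕜 := ℝ) P x, y⟫ = ⟪x, toEuclideanCLM (𝕜 := ℝ) Pᵀ y⟫ := by
  rw [real_inner_comm, inner_toEuclideanCLM, inner_toEuclideanCLM, dotProduct_mulVec,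
    ← mulVec_transpose, dotProduct_comm]

lemma inner_toEuclideanCLM_self_nonneg {P : Matrix (Fin d) (Fin d) ℝ} (hP : P.PosSemidef)
    (x : EuclideanSpace ℝ (Fin d)) : 0 ≤ ⟪x, toEuclideanCLM (𝕜 := ℝ) P x⟫ := by
  rw [inner_toEuclideanCLM]
  simpa using hP.dotProduct_mulVec_nonneg x.ofLp

/-- The image of a Gaussian measure under an affine map. -/
lemma map_affineMap_multivariateGaussian (hS : S.PosSemidef) (c : EuclideanSpace ℝ (Fin d))
    (P : Matrix (Fin d) (Fin d) ℝ) :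
    (multivariateGaussian m S).map (affineMap m c P) =
      multivariateGaussian c (P * S * Pᵀ) := by
  have hPS : (P * S * Pᵀ).PosSemidef := hS.mul_mul_conjTranspose_same P
  refine Measure.ext_of_charFun (funext fun ξ => ?_)
  rw [charFun_multivariateGaussian hPS, charFun_apply, integral_map (by fun_prop) (by fun_prop)]
  have h : ∀ x : EuclideanSpace ℝ (Fin d), ⟪affineMap m c P x, ξ⟫ =
      ⟪x, toEuclideanCLM (𝕜 := ℝ) Pᵀ ξ⟫ + (⟪c, ξ⟫ - ⟪m, toEuclideanCLM (𝕜 := ℝ) Pᵀ ξ⟫) := by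
    intro x
    rw [affineMap, inner_add_left, inner_toEuclideanCLM_left, inner_sub_left]
    ring
  simp_rw [h, Complex.ofReal_add, add_mul, Complex.exp_add]
  rw [integral_mul_const, ← charFun_apply, charFun_multivariateGaussian hS, ← Complex.exp_add]
  congr 1
  have hq : (toEuclideanCLM (𝕜 := ℝ) Pᵀ ξ).ofLp ⬝ᵥ S *ᵥ (toEuclideanCLM (𝕜 := ℝ) Pᵀ ξ).ofLp
      = ξ.ofLp ⬝ᵥ (P * S * Pᵀ) *ᵥ ξ.ofLp := by
    rw [ofLp_toEuclideanCLM, mulVec_transpose, ← dotProduct_mulVec, ← mulVec_transpose,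
      mulVec_mulVec, mulVec_mulVec]
  rw [hq, real_inner_comm m, real_inner_comm c]
  push_cast
  ring

lemma integrable_inner_sub (a : EuclideanSpace ℝ (Fin d)) :
    Integrable (fun x => ⟪a, x - m⟫) (multivariateGaussian m S) :=
  (IsGaussian.integrable_fun_id.sub (integrable_const m)).const_inner a

lemma integral_inner_sub (a : EuclideanSpace ℝ (Fin d)) :
    ∫ x, ⟪a, x - m⟫ ∂(multivariateGaussian m S) = 0 := by
  have hi : Integrable (fun x => x - m) (multivariateGaussian m S) :=
    IsGaussian.integrable_fun_id.sub (integrable_const m)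
  rw [integral_inner hi, integral_sub IsGaussian.integrable_fun_id (integrable_const m)]
  simp

lemma memLp_eval_sub (i : Fin d) :
    MemLp (fun x : EuclideanSpace ℝ (Fin d) => x i - m i) 2 (multivariateGaussian m S) := by
  have h : MemLp (fun x : EuclideanSpace ℝ (Fin d) => x) 2 (multivariateGaussian m S) :=
    IsGaussian.memLp_two_id
  exact (h.continuousLinearMap_comp (EuclideanSpace.proj (𝕜 := ℝ) i)).sub (memLp_const _)

lemma integral_eval_multivariateGaussian (i : Fin d) :
    ∫ x, x i ∂(multivariateGaussian m S) = m i := by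
  have := (EuclideanSpace.proj (𝕜 := ℝ) i).integral_comp_comm
    (IsGaussian.integrable_fun_id (μ := multivariateGaussian m S))
  simpa using this

lemma integral_eval_sub_mul_eval_sub (hS : S.PosSemidef) (i j : Fin d) :
    ∫ x, (x i - m i) * (x j - m j) ∂(multivariateGaussian m S) = S i j := by
  have := covariance_eval_multivariateGaussian (μ := m) hS i j
  simpa only [covariance, integral_eval_multivariateGaussian] using this

lemma inner_toEuclideanCLM_eq_sum (Q : Matrix (Fin d) (Fin d) ℝ)
    (x : EuclideanSpace ℝ (Fin d)) :
    ⟪x, toEuclideanCLM (𝕜 := ℝ) Q x⟫ = ∑ i, ∑ j, Q i j * (x i * x j) := by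
  rw [inner_toEuclideanCLM, dotProduct]
  refine Finset.sum_congr rfl fun i _ => ?_
  rw [mulVec, dotProduct, Finset.mul_sum]
  exact Finset.sum_congr rfl fun j _ => by ring

lemma integrable_quadratic (Q : Matrix (Fin d) (Fin d) ℝ) :
    Integrable (fun x => ⟪x - m, toEuclideanCLM (𝕜 := ℝ) Q (x - m)⟫)
      (multivariateGaussian m S) := by
  simp_rw [inner_toEuclideanCLM_eq_sum]
  exact integrable_finsetSum _ fun i _ => integrable_finsetSum _ fun j _ =>
    ((memLp_eval_sub i).integrable_mul (memLp_eval_sub j)).const_mul _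

lemma integral_quadratic (hS : S.PosSemidef) (Q : Matrix (Fin d) (Fin d) ℝ) :
    ∫ x, ⟪x - m, toEuclideanCLM (𝕜 := ℝ) Q (x - m)⟫ ∂(multivariateGaussian m S) =
      (Q * S).trace := by
  have hint : ∀ i j, Integrable (fun x : EuclideanSpace ℝ (Fin d) =>
      Q i j * ((x i - m i) * (x j - m j))) (multivariateGaussian m S) := fun i j =>
    ((memLp_eval_sub i).integrable_mul (memLp_eval_sub j)).const_mul _
  simp_rw [inner_toEuclideanCLM_eq_sum, PiLp.sub_apply]
  rw [integral_finsetSum _ fun i _ => integrable_finsetSum _ fun j _ => hint i j, Matrix.trace]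
  refine Finset.sum_congr rfl fun i _ => ?_
  rw [integral_finsetSum _ fun j _ => hint i j, diag_apply, mul_apply]
  refine Finset.sum_congr rfl fun j _ => ?_
  rw [integral_const_mul, integral_eval_sub_mul_eval_sub hS]
  rw [show S i j = S j i by simpa using hS.isHermitian.apply j i]

/-- The function `x ↦ k + ⟪a, x - m⟫ + ⟪x - m, Q (x - m)⟫`. -/
noncomputable def quadraticFun (m : EuclideanSpace ℝ (Fin d)) (k : ℝ)
    (a : EuclideanSpace ℝ (Fin d)) (Q : Matrix (Fin d) (Fin d) ℝ)
    (x : EuclideanSpace ℝ (Fin d)) : ℝ :=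
  k + ⟪a, x - m⟫ + ⟪x - m, toEuclideanCLM (𝕜 := ℝ) Q (x - m)⟫

lemma integrable_quadraticFun (k : ℝ) (a : EuclideanSpace ℝ (Fin d))
    (Q : Matrix (Fin d) (Fin d) ℝ) :
    Integrable (quadraticFun m k a Q) (multivariateGaussian m S) :=
  ((integrable_const k).add (integrable_inner_sub a)).add (integrable_quadratic Q)

lemma integral_quadraticFun (hS : S.PosSemidef) (k : ℝ) (a : EuclideanSpace ℝ (Fin d))
    (Q : Matrix (Fin d) (Fin d) ℝ) :
    ∫ x, quadraticFun m k a Q x ∂(multivariateGaussian m S) = k + (Q * S).trace := by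
  have h1 : Integrable (fun x => k + ⟪a, x - m⟫) (multivariateGaussian m S) :=
    (integrable_const k).add (integrable_inner_sub a)
  simp only [quadraticFun]
  rw [integral_add h1 (integrable_quadratic Q),
    integral_add (integrable_const k) (integrable_inner_sub a), integral_inner_sub,
    integral_quadratic hS]
  simp

/-- The squared displacement of a symmetric affine map is a quadratic function. -/
lemma norm_sub_affineMap_sq (c x : EuclideanSpace ℝ (Fin d)) {P : Matrix (Fin d) (Fin d) ℝ}
    (hP : Pᵀ = P) :
    ‖x - affineMap m c P x‖ ^ 2 = quadraticFun m (‖m - c‖ ^ 2)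
      ((2 : ℝ) • toEuclideanCLM (𝕜 := ℝ) (1 - P) (m - c)) ((1 - P) * (1 - P)) x := by
  have hx : x - affineMap m c P x = (m - c) + toEuclideanCLM (𝕜 := ℝ) (1 - P) (x - m) := by
    rw [affineMap, map_sub (toEuclideanCLM (𝕜 := ℝ)) 1 P, map_one]
    simp only [_root_.sub_apply, one_apply_eq_self]
    abel
  have hQ : (1 - P)ᵀ = 1 - P := by rw [transpose_sub, transpose_one, hP]
  rw [hx, norm_add_sq_real, quadraticFun, real_inner_smul_left, inner_toEuclideanCLM_left, hQ,
    map_mul, mul_apply_eq_comp,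
    ← real_inner_self_eq_norm_sq (toEuclideanCLM (𝕜 := ℝ) (1 - P) (x - m)),
    inner_toEuclideanCLM_left (1 - P) (x - m), hQ]

end Gaussian

end BuresWasserstein

namespace BuresWasserstein

open Matrix

/-! ### Wasserstein distance of a Gaussian to its affine images. -/

section Wasserstein

variable {d : ℕ} {μ ν : Measure (EuclideanSpace ℝ (Fin d))}

lemma W2_nonneg (μ ν : Measure (EuclideanSpace ℝ (Fin d))) : 0 ≤ W2 μ ν := Real.sqrt_nonneg _

lemma W2_sq (μ ν : Measure (EuclideanSpace ℝ (Fin d))) :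
    W2 μ ν ^ 2 = (⨅ γ ∈ Couplings μ ν, ∫⁻ p, ‖p.1 - p.2‖ₑ ^ 2 ∂γ).toReal :=
  Real.sq_sqrt ENNReal.toReal_nonneg

lemma ofReal_W2_sq_le {γ : Measure (EuclideanSpace ℝ (Fin d) × EuclideanSpace ℝ (Fin d))}
    (hγ : γ ∈ Couplings μ ν) :
    ENNReal.ofReal (W2 μ ν ^ 2) ≤ ∫⁻ p, ‖p.1 - p.2‖ₑ ^ 2 ∂γ := by
  rw [W2_sq]
  exact ENNReal.ofReal_toReal_le.trans (iInf₂_le γ hγ)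

lemma exists_coupling_lintegral_lt (h : 0 < W2 μ ν) {ε : ℝ} (hε : 0 < ε) :
    ∃ γ ∈ Couplings μ ν, ∫⁻ p, ‖p.1 - p.2‖ₑ ^ 2 ∂γ < ENNReal.ofReal (W2 μ ν ^ 2 + ε) := by
  have hlt : (⨅ γ ∈ Couplings μ ν, ∫⁻ p, ‖p.1 - p.2‖ₑ ^ 2 ∂γ) <
      ENNReal.ofReal (W2 μ ν ^ 2 + ε) := by
    -- An infinite infimum would make `W2` equal to zero through `toReal`.
    have hfin : (⨅ γ ∈ Couplings μ ν, ∫⁻ p, ‖p.1 - p.2‖ₑ ^ 2 ∂γ) ≠ ∞ := by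
      intro htop
      simp [W2, htop] at h
    rw [ENNReal.lt_ofReal_iff_toReal_lt hfin, ← W2_sq]
    linarith
  simpa only [iInf_lt_iff, exists_prop] using hlt

/-- A lower bound on the cost of all couplings bounds the Wasserstein distance from below, as soon
as some coupling has finite cost. -/
lemma le_W2_sq {c : ℝ}
    (h : ∀ γ ∈ Couplings μ ν, ENNReal.ofReal c ≤ ∫⁻ p, ‖p.1 - p.2‖ₑ ^ 2 ∂γ)
    (hfin : ∃ γ ∈ Couplings μ ν, ∫⁻ p, ‖p.1 - p.2‖ₑ ^ 2 ∂γ ≠ ∞) : c ≤ W2 μ ν ^ 2 := by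
  obtain ⟨γ, hγ, hγfin⟩ := hfin
  rw [W2_sq, ← ENNReal.ofReal_le_iff_le_toReal]
  · exact le_iInf₂ h
  · exact ne_top_of_le_ne_top hγfin (iInf₂_le γ hγ)

/-- The joint law of two measurable maps is a coupling of their laws. -/
lemma map_prodMk_mem_couplings {f g : EuclideanSpace ℝ (Fin d) → EuclideanSpace ℝ (Fin d)}
    (hf : Measurable f) (hg : Measurable g) (ρ : Measure (EuclideanSpace ℝ (Fin d))) :
    ρ.map (fun x => (f x, g x)) ∈ Couplings (ρ.map f) (ρ.map g) := by
  constructor <;> rw [Measure.map_map (by fun_prop) (by fun_prop)] <;> rfl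

lemma lintegral_enorm_sq_eq {α : Type*} [MeasurableSpace α] {ρ : Measure α}
    {f : α → EuclideanSpace ℝ (Fin d)} (hf : Integrable (fun x => ‖f x‖ ^ 2) ρ) :
    ∫⁻ x, ‖f x‖ₑ ^ 2 ∂ρ = ENNReal.ofReal (∫ x, ‖f x‖ ^ 2 ∂ρ) := by
  rw [ofReal_integral_eq_lintegral_ofReal hf (Eventually.of_forall fun x => by positivity)]
  refine lintegral_congr fun x => ?_
  rw [ENNReal.ofReal_pow (norm_nonneg _), ofReal_norm]

lemma trace_one_sub_mul_self_mul (P S : Matrix (Fin d) (Fin d) ℝ) :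
    ((1 - P) * (1 - P) * S).trace = S.trace + (P * S * P).trace - 2 * (P * S).trace := by
  rw [trace_mul_cycle P S P, show (1 - P) * (1 - P) * S = S + P * P * S - (P * S + P * S) by
    noncomm_ring, trace_sub, trace_add, trace_add]
  ring

variable {m c : EuclideanSpace ℝ (Fin d)} {S P : Matrix (Fin d) (Fin d) ℝ}

lemma lintegral_enorm_sub_affineMap_sq (hS : S.PosSemidef) (hP : Pᵀ = P) :
    ∫⁻ x, ‖x - affineMap m c P x‖ₑ ^ 2 ∂(multivariateGaussian m S) =
      ENNReal.ofReal (‖m - c‖ ^ 2 + (S.trace + (P * S * P).trace - 2 * (P * S).trace)) := by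
  have hi : Integrable (fun x => ‖x - affineMap m c P x‖ ^ 2) (multivariateGaussian m S) := by
    simp_rw [norm_sub_affineMap_sq c _ hP]
    exact integrable_quadraticFun _ _ _
  rw [lintegral_enorm_sq_eq hi]
  simp_rw [norm_sub_affineMap_sq c _ hP]
  rw [integral_quadraticFun hS, trace_one_sub_mul_self_mul]

lemma affine_coupling_mem (hS : S.PosSemidef) (hP : Pᵀ = P) :
    (multivariateGaussian m S).map (fun x => (x, affineMap m c P x)) ∈
      Couplings (multivariateGaussian m S) (multivariateGaussian c (P * S * P)) := by
  have := map_prodMk_mem_couplings measurable_id (measurable_affineMap m c P)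
    (multivariateGaussian m S)
  rwa [Measure.map_id, map_affineMap_multivariateGaussian hS, hP] at this

lemma lintegral_affine_coupling (hS : S.PosSemidef) (hP : Pᵀ = P) :
    ∫⁻ p, ‖p.1 - p.2‖ₑ ^ 2
        ∂((multivariateGaussian m S).map (fun x => (x, affineMap m c P x))) =
      ENNReal.ofReal (‖m - c‖ ^ 2 + (S.trace + (P * S * P).trace - 2 * (P * S).trace)) := by
  rw [lintegral_map (by fun_prop) (by fun_prop)]
  exact lintegral_enorm_sub_affineMap_sq hS hP

lemma displacement_nonneg (hS : S.PosSemidef) (hP : Pᵀ = P) :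
    0 ≤ ‖m - c‖ ^ 2 + (S.trace + (P * S * P).trace - 2 * (P * S).trace) := by
  have h := (hS.conjTranspose_mul_mul_same (1 - P)).trace_nonneg
  rw [show (1 - P)ᴴ = 1 - P by
      rw [conjTranspose_eq_transpose_of_trivial, transpose_sub, transpose_one, hP],
    trace_mul_cycle, trace_one_sub_mul_self_mul] at h
  positivity

lemma W2_sq_affine_le (hS : S.PosSemidef) (hP : Pᵀ = P) :
    W2 (multivariateGaussian m S) (multivariateGaussian c (P * S * P)) ^ 2 ≤
      ‖m - c‖ ^ 2 + (S.trace + (P * S * P).trace - 2 * (P * S).trace) := by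
  have h := ofReal_W2_sq_le (affine_coupling_mem (m := m) (c := c) hS hP)
  rw [lintegral_affine_coupling hS hP] at h
  exact (ENNReal.ofReal_le_ofReal_iff (displacement_nonneg hS hP)).1 h

/-- Young's inequality for the quadratic forms of a positive definite matrix and its inverse. -/
lemma two_mul_inner_le (hP : P.PosDef) (x y : EuclideanSpace ℝ (Fin d)) :
    2 * ⟪x, y⟫ ≤ ⟪x, toEuclideanCLM (𝕜 := ℝ) P x⟫ + ⟪y, toEuclideanCLM (𝕜 := ℝ) P⁻¹ y⟫ := by
  have hinv : ∀ z, toEuclideanCLM (𝕜 := ℝ) P (toEuclideanCLM (𝕜 := ℝ) P⁻¹ z) = z := by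
    intro z
    rw [← mul_apply_eq_comp, ← map_mul,
      mul_nonsing_inv _ ((isUnit_iff_isUnit_det _).1 hP.isUnit), map_one]
    rfl
  have hT : Pᵀ = P := hP.isHermitian
  have h := inner_toEuclideanCLM_self_nonneg hP.posSemidef (x - toEuclideanCLM (𝕜 := ℝ) P⁻¹ y)
  have h2 : ⟪toEuclideanCLM (𝕜 := ℝ) P⁻¹ y, toEuclideanCLM (𝕜 := ℝ) P x⟫ = ⟪x, y⟫ := by
    rw [real_inner_comm, inner_toEuclideanCLM_left, hT, hinv]
  rw [map_sub, hinv, inner_sub_left, inner_sub_right, inner_sub_right, h2,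
    real_inner_comm y (toEuclideanCLM (𝕜 := ℝ) P⁻¹ y)] at h
  linarith

/-- Weak Kantorovich duality: quadratic potentials with f(x) + g(y) ≤ ‖x - y‖² bound the cost of
every coupling by integrals over the marginals alone, and these add up to the cost of the affine
map. -/
lemma le_W2_sq_affine (hS : S.PosSemidef) (hP : P.PosDef) :
    ‖m - c‖ ^ 2 + (S.trace + (P * S * P).trace - 2 * (P * S).trace) ≤
      W2 (multivariateGaussian m S) (multivariateGaussian c (P * S * P)) ^ 2 := by
  have hT : Pᵀ = P := hP.isHermitian
  have hS' : (P * S * P).PosSemidef := by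
    simpa only [conjTranspose_eq_transpose_of_trivial, hT] using hS.mul_mul_conjTranspose_same P
  refine le_W2_sq (fun γ hγ => ?_) ⟨_, affine_coupling_mem hS hT, ?_⟩
  swap
  · rw [lintegral_affine_coupling hS hT]; exact ENNReal.ofReal_ne_top
  by_cases htop : ∫⁻ p, ‖p.1 - p.2‖ₑ ^ 2 ∂γ = ∞
  · rw [htop]; exact le_top
  have hγi : Integrable (fun p : EuclideanSpace ℝ (Fin d) × EuclideanSpace ℝ (Fin d) =>
      ‖p.1 - p.2‖ ^ 2) γ := by
    refine ⟨by fun_prop, ?_⟩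
    rw [HasFiniteIntegral]
    convert lt_top_iff_ne_top.2 htop using 3 with p
    simp
  rw [lintegral_enorm_sq_eq hγi]
  refine ENNReal.ofReal_le_ofReal ?_
  -- Chosen so that ‖x - y‖² - f(x) - g(y) is exactly the slack in Young's inequality for x - m and
  -- y - c, which vanishes on the graph of the affine map.
  set f := quadraticFun m (‖m - c‖ ^ 2) ((2 : ℝ) • (m - c)) (1 - P)
  set g := quadraticFun c 0 (-(2 : ℝ) • (m - c)) (1 - P⁻¹)
  have hf : Integrable (fun p : EuclideanSpace ℝ (Fin d) × EuclideanSpace ℝ (Fin d) => f p.1) γ :=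
    Integrable.comp_measurable (g := f) (by rw [hγ.1]; exact integrable_quadraticFun _ _ _)
      measurable_fst
  have hg : Integrable (fun p : EuclideanSpace ℝ (Fin d) × EuclideanSpace ℝ (Fin d) => g p.2) γ :=
    Integrable.comp_measurable (g := g) (by rw [hγ.2]; exact integrable_quadraticFun _ _ _)
      measurable_snd
  have hfi : ∫ p, f p.1 ∂γ = ‖m - c‖ ^ 2 + ((1 - P) * S).trace := by
    rw [← integral_quadraticFun (m := m) hS, ← hγ.1, integral_map measurable_fst.aemeasurable]
    rw [hγ.1]
    exact (integrable_quadraticFun _ _ _).aestronglyMeasurable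
  have hgi : ∫ p, g p.2 ∂γ = 0 + ((1 - P⁻¹) * (P * S * P)).trace := by
    rw [← integral_quadraticFun (m := c) hS', ← hγ.2, integral_map measurable_snd.aemeasurable]
    rw [hγ.2]
    exact (integrable_quadraticFun _ _ _).aestronglyMeasurable
  have hPi : P⁻¹ * P = 1 := nonsing_inv_mul _ ((isUnit_iff_isUnit_det _).1 hP.isUnit)
  have htr : ((1 - P⁻¹) * (P * S * P)).trace = (P * S * P).trace - (P * S).trace := by
    rw [show (1 - P⁻¹) * (P * S * P) = P * S * P - (P⁻¹ * P) * (S * P) by noncomm_ring, hPi,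
      one_mul, trace_sub, trace_mul_comm S P]
  have htr' : ((1 - P) * S).trace = S.trace - (P * S).trace := by
    rw [sub_mul, one_mul, trace_sub]
  calc _ = ∫ p, (f p.1 + g p.2) ∂γ := by
        rw [integral_add hf hg, hfi, hgi, htr, htr']; ring
    _ ≤ _ := integral_mono (hf.add hg) hγi fun p => ?_
  have hxy : p.1 - p.2 = (m - c) + ((p.1 - m) - (p.2 - c)) := by abel
  have hY := two_mul_inner_le hP (p.1 - m) (p.2 - c)
  simp only [f, g, quadraticFun]
  rw [hxy, norm_add_sq_real, norm_sub_sq_real (p.1 - m),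
    inner_sub_right (m - c), real_inner_smul_left,
    real_inner_smul_left, map_sub (toEuclideanCLM (𝕜 := ℝ)) 1 P,
    map_sub (toEuclideanCLM (𝕜 := ℝ)) 1 P⁻¹, map_one, _root_.sub_apply,
    _root_.sub_apply, one_apply_eq_self, one_apply_eq_self,
    inner_sub_right (p.1 - m), inner_sub_right (p.2 - c), real_inner_self_eq_norm_sq,
    real_inner_self_eq_norm_sq]
  linarith

lemma W2_sq_affine (hS : S.PosSemidef) (hP : P.PosDef) :
    W2 (multivariateGaussian m S) (multivariateGaussian c (P * S * P)) ^ 2 =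
      ‖m - c‖ ^ 2 + (S.trace + (P * S * P).trace - 2 * (P * S).trace) :=
  le_antisymm (W2_sq_affine_le hS hP.isHermitian) (le_W2_sq_affine hS hP)

lemma W2_comm (μ ν : Measure (EuclideanSpace ℝ (Fin d))) : W2 μ ν = W2 ν μ := by
  have key : ∀ μ ν : Measure (EuclideanSpace ℝ (Fin d)),
      (⨅ γ ∈ Couplings μ ν, ∫⁻ p, ‖p.1 - p.2‖ₑ ^ 2 ∂γ) ≤
        ⨅ γ ∈ Couplings ν μ, ∫⁻ p, ‖p.1 - p.2‖ₑ ^ 2 ∂γ := by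
    refine fun μ ν => le_iInf₂ fun γ hγ => ?_
    have hswap : γ.map Prod.swap ∈ Couplings μ ν := by
      constructor
      · rw [Measure.map_map measurable_fst measurable_swap]; exact hγ.2
      · rw [Measure.map_map measurable_snd measurable_swap]; exact hγ.1
    refine (iInf₂_le _ hswap).trans (le_of_eq ?_)
    · rw [lintegral_map (by fun_prop) measurable_swap]
      exact lintegral_congr fun p => by rw [Prod.fst_swap, Prod.snd_swap, ← enorm_neg, neg_sub]
  rw [W2, W2, le_antisymm (key μ ν) (key ν μ)]

end Wasserstein

end BuresWasserstein

namespace BuresWasserstein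

open Matrix

/-! ### Extending a geodesic past time one. -/

section GeodesicExtension

variable {d : ℕ}

lemma norm_exp_inner_sub_exp_inner_le (x y ξ : EuclideanSpace ℝ (Fin d)) :
    ‖Complex.exp (⟪x, ξ⟫ * Complex.I) - Complex.exp (⟪y, ξ⟫ * Complex.I)‖ ≤ ‖x - y‖ * ‖ξ‖ := by
  have h : Complex.exp (⟪x, ξ⟫ * Complex.I) - Complex.exp (⟪y, ξ⟫ * Complex.I) =
      Complex.exp (⟪y, ξ⟫ * Complex.I) * (Complex.exp (Complex.I * (⟪x - y, ξ⟫ : ℝ)) - 1) := by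
    rw [mul_sub, ← Complex.exp_add, mul_one, inner_sub_left]
    congr 2
    push_cast
    ring
  rw [h, norm_mul, Complex.norm_exp_ofReal_mul_I, one_mul]
  exact (Real.norm_exp_I_mul_ofReal_sub_one_le).trans (norm_inner_le_norm _ _)

/-- Two probability measures admitting couplings of arbitrarily small quadratic cost are equal. -/
lemma eq_of_forall_exists_coupling {μ ν : Measure (EuclideanSpace ℝ (Fin d))}
    [IsProbabilityMeasure μ] [IsFiniteMeasure ν]
    (h : ∀ ε : ℝ, 0 < ε →
      ∃ γ ∈ Couplings μ ν, ∫⁻ p, ‖p.1 - p.2‖ₑ ^ 2 ∂γ ≤ ENNReal.ofReal ε) : μ = ν := by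
  refine Measure.ext_of_charFun (funext fun ξ => ?_)
  rw [← sub_eq_zero, ← norm_le_zero_iff]
  have key : ∀ η : ℝ, 0 < η → ‖charFun μ ξ - charFun ν ξ‖ ≤ ‖ξ‖ * η := by
    intro η hη
    -- With cost at most η², both terms of the bound ‖x - y‖ ≤ (η + η⁻¹‖x - y‖²)/2 contribute at
    -- most η/2.
    obtain ⟨γ, ⟨h1, h2⟩, hγ⟩ := h (η ^ 2) (by positivity)
    have hprob : IsProbabilityMeasure γ := by
      refine ⟨?_⟩
      have := measure_univ (μ := μ)
      rwa [← h1, Measure.map_apply measurable_fst MeasurableSet.univ, Set.preimage_univ] at this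
    have hbd : ∀ f : EuclideanSpace ℝ (Fin d) × EuclideanSpace ℝ (Fin d) → EuclideanSpace ℝ (Fin d),
        Measurable f → Integrable (fun p => Complex.exp (⟪f p, ξ⟫ * Complex.I)) γ := by
      intro f hf
      refine Integrable.of_bound (by fun_prop) 1 (Eventually.of_forall fun p => ?_)
      rw [Complex.norm_exp_ofReal_mul_I]
    have hsq : Integrable (fun p : EuclideanSpace ℝ (Fin d) × EuclideanSpace ℝ (Fin d) =>
        ‖p.1 - p.2‖ ^ 2) γ := by
      refine ⟨by fun_prop, ?_⟩
      rw [HasFiniteIntegral]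
      refine lt_of_le_of_lt (le_of_eq ?_) (hγ.trans_lt ENNReal.ofReal_lt_top)
      simp
    have hsqle : ∫ p, ‖p.1 - p.2‖ ^ 2 ∂γ ≤ η ^ 2 := by
      rwa [lintegral_enorm_sq_eq hsq, ENNReal.ofReal_le_ofReal_iff (by positivity)] at hγ
    have hμξ : charFun μ ξ = ∫ p, Complex.exp (⟪p.1, ξ⟫ * Complex.I) ∂γ := by
      rw [charFun_apply, ← h1, integral_map measurable_fst.aemeasurable (by fun_prop)]
    have hνξ : charFun ν ξ = ∫ p, Complex.exp (⟪p.2, ξ⟫ * Complex.I) ∂γ := by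
      rw [charFun_apply, ← h2, integral_map measurable_snd.aemeasurable (by fun_prop)]
    rw [hμξ, hνξ, ← integral_sub (hbd _ measurable_fst) (hbd _ measurable_snd)]
    calc _ ≤ ∫ p, ‖ξ‖ / 2 * (η + η⁻¹ * ‖p.1 - p.2‖ ^ 2) ∂γ := by
          refine norm_integral_le_of_norm_le
            (((integrable_const η).add (hsq.const_mul _)).const_mul _)
            (Eventually.of_forall fun p => ?_)
          refine (norm_exp_inner_sub_exp_inner_le _ _ _).trans ?_
          have h3 : ‖p.1 - p.2‖ ≤ (η + η⁻¹ * ‖p.1 - p.2‖ ^ 2) / 2 := by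
            have h4 := mul_nonneg (inv_nonneg.2 hη.le) (sq_nonneg (η - ‖p.1 - p.2‖))
            have h5 : η⁻¹ * (η - ‖p.1 - p.2‖) ^ 2 =
                η + η⁻¹ * ‖p.1 - p.2‖ ^ 2 - 2 * ‖p.1 - p.2‖ := by
              field_simp; ring
            linarith
          calc _ ≤ (η + η⁻¹ * ‖p.1 - p.2‖ ^ 2) / 2 * ‖ξ‖ := by gcongr
            _ = _ := by ring
      _ = ‖ξ‖ / 2 * (η + η⁻¹ * ∫ p, ‖p.1 - p.2‖ ^ 2 ∂γ) := by
          rw [integral_const_mul, integral_add (integrable_const η) (hsq.const_mul _),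
            integral_const_mul]
          simp
      _ ≤ ‖ξ‖ / 2 * (η + η⁻¹ * η ^ 2) := by gcongr
      _ = ‖ξ‖ * η := by field_simp; ring
  have hlim : Tendsto (fun η : ℝ => ‖ξ‖ * η) (𝓝[>] 0) (𝓝 0) := by
    have : Tendsto (fun η : ℝ => ‖ξ‖ * η) (𝓝 0) (𝓝 (‖ξ‖ * 0)) := tendsto_id.const_mul _
    rw [mul_zero] at this
    exact this.mono_left nhdsWithin_le_nhds
  exact ge_of_tendsto hlim (eventually_nhdsWithin_of_forall key)

/-- Stewart's identity: y divides the segment from z to the extrapolated point in the ratio 1 : t -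
1. The terms are arranged so that all coefficients are nonnegative for t ≥ 1, as integration in [0,
∞] requires. -/
lemma norm_sub_extrapolation_sq (x y z : EuclideanSpace ℝ (Fin d)) (t : ℝ) :
    ‖x - (y + (t - 1) • (y - z))‖ ^ 2 + (t - 1) * ‖x - z‖ ^ 2 =
      t * ‖x - y‖ ^ 2 + t * (t - 1) * ‖y - z‖ ^ 2 := by
  have h1 : x - (y + (t - 1) • (y - z)) = (x - y) - (t - 1) • (y - z) := by abel
  have h2 : x - z = (x - y) + (y - z) := by abel
  rw [h1, h2, norm_sub_sq_real, norm_add_sq_real, real_inner_smul_right, norm_smul, mul_pow,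
    Real.norm_eq_abs, sq_abs]
  ring

lemma enorm_sub_extrapolation_sq (x y z : EuclideanSpace ℝ (Fin d)) {t : ℝ} (ht : 1 ≤ t) :
    ‖x - (y + (t - 1) • (y - z))‖ₑ ^ 2 + ENNReal.ofReal (t - 1) * ‖x - z‖ₑ ^ 2 =
      ENNReal.ofReal t * ‖x - y‖ₑ ^ 2 + ENNReal.ofReal (t * (t - 1)) * ‖y - z‖ₑ ^ 2 := by
  have ht' : 0 ≤ t - 1 := by linarith
  have ht0 : 0 ≤ t := by linarith
  simp_rw [← ofReal_norm, ← ENNReal.ofReal_pow (norm_nonneg _)]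
  rw [← ENNReal.ofReal_mul ht', ← ENNReal.ofReal_mul ht0, ← ENNReal.ofReal_mul (by positivity),
    ← ENNReal.ofReal_add (by positivity) (by positivity),
    ← ENNReal.ofReal_add (by positivity) (by positivity), norm_sub_extrapolation_sq]

/-- If the map `g` transports `β` at cost one, then a measure `ρ` at
distance `t - 1` from `β` and `t` from the image of `β` is obtained by extrapolation. -/
lemma eq_map_extrapolation {β ρ : Measure (EuclideanSpace ℝ (Fin d))}
    [IsProbabilityMeasure ρ] [IsProbabilityMeasure β]
    {g : EuclideanSpace ℝ (Fin d) → EuclideanSpace ℝ (Fin d)} (hg : Measurable g)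
    (hcost : ∫⁻ x, ‖x - g x‖ₑ ^ 2 ∂β = 1) {t : ℝ} (ht : 1 < t)
    (h1 : W2 ρ β = t - 1) (h0 : W2 ρ (β.map g) = t) :
    ρ = β.map (fun x => x + (t - 1) • (x - g x)) := by
  have ht' : 0 < t - 1 := by linarith
  have ht0 : 0 < t := by linarith
  set e := fun x => x + (t - 1) • (x - g x) with he
  have hem : Measurable e := by fun_prop
  have : IsProbabilityMeasure (β.map e) := Measure.isProbabilityMeasure_map hem.aemeasurable
  refine eq_of_forall_exists_coupling fun ε hε => ?_
  -- The excess ε / t is multiplied by t in Stewart's identity.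
  obtain ⟨γ, ⟨hγ1, hγ2⟩, hγ⟩ := exists_coupling_lintegral_lt (h1 ▸ ht' : 0 < W2 ρ β)
    (ε := ε / t) (by positivity)
  rw [h1] at hγ
  have hcoup : ∀ f : EuclideanSpace ℝ (Fin d) → EuclideanSpace ℝ (Fin d), Measurable f →
      γ.map (fun p => (p.1, f p.2)) ∈ Couplings ρ (β.map f) := by
    intro f hf
    constructor
    · rw [Measure.map_map (by fun_prop) (by fun_prop)]; exact hγ1
    · rw [← hγ2, Measure.map_map (by fun_prop) (by fun_prop), Measure.map_map hf (by fun_prop)]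
      rfl
  have hcost' : ∀ f : EuclideanSpace ℝ (Fin d) → EuclideanSpace ℝ (Fin d), Measurable f →
      ∫⁻ p, ‖p.1 - p.2‖ₑ ^ 2 ∂(γ.map (fun p => (p.1, f p.2))) =
        ∫⁻ p, ‖p.1 - f p.2‖ₑ ^ 2 ∂γ := fun f hf => by
    rw [lintegral_map (by fun_prop) (by fun_prop)]
  refine ⟨_, hcoup e hem, ?_⟩
  rw [hcost' e hem]
  have hlow : ENNReal.ofReal (t ^ 2) ≤ ∫⁻ p, ‖p.1 - g p.2‖ₑ ^ 2 ∂γ := by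
    rw [← hcost' g hg, ← h0]
    exact ofReal_W2_sq_le (hcoup g hg)
  have hu : ∫⁻ p, ‖p.2 - g p.2‖ₑ ^ 2 ∂γ = 1 := by
    rw [← hcost, ← hγ2, lintegral_map (by fun_prop) measurable_snd]
  have hid : ∫⁻ p, ‖p.1 - e p.2‖ₑ ^ 2 ∂γ +
      ENNReal.ofReal (t - 1) * ∫⁻ p, ‖p.1 - g p.2‖ₑ ^ 2 ∂γ =
      ENNReal.ofReal t * ∫⁻ p, ‖p.1 - p.2‖ₑ ^ 2 ∂γ + ENNReal.ofReal (t * (t - 1)) := by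
    have me : Measurable fun p : EuclideanSpace ℝ (Fin d) × EuclideanSpace ℝ (Fin d) =>
      ‖p.1 - e p.2‖ₑ ^ 2 := by fun_prop
    have mg : Measurable fun p : EuclideanSpace ℝ (Fin d) × EuclideanSpace ℝ (Fin d) =>
      ‖p.1 - g p.2‖ₑ ^ 2 := by fun_prop
    have mp : Measurable fun p : EuclideanSpace ℝ (Fin d) × EuclideanSpace ℝ (Fin d) =>
      ‖p.1 - p.2‖ₑ ^ 2 := by fun_prop
    have mu : Measurable fun p : EuclideanSpace ℝ (Fin d) × EuclideanSpace ℝ (Fin d) =>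
      ‖p.2 - g p.2‖ₑ ^ 2 := by fun_prop
    calc _ = ∫⁻ p, (‖p.1 - e p.2‖ₑ ^ 2 + ENNReal.ofReal (t - 1) * ‖p.1 - g p.2‖ₑ ^ 2) ∂γ := by
          rw [lintegral_add_left me, lintegral_const_mul _ mg]
      _ = ∫⁻ p, (ENNReal.ofReal t * ‖p.1 - p.2‖ₑ ^ 2 +
            ENNReal.ofReal (t * (t - 1)) * ‖p.2 - g p.2‖ₑ ^ 2) ∂γ :=
          lintegral_congr fun p => enorm_sub_extrapolation_sq p.1 p.2 (g p.2) ht.le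
      _ = _ := by
          rw [lintegral_add_left (mp.const_mul _), lintegral_const_mul _ mp,
            lintegral_const_mul _ mu, hu, mul_one]
  have hfin : ENNReal.ofReal ((t - 1) * t ^ 2) ≠ ∞ := ENNReal.ofReal_ne_top
  -- The lower bound t² on the cost to the image under g supplies the summand (t - 1)t², which
  -- cancels since t(t - 1)² + t(t - 1) = (t - 1)t².
  refine (ENNReal.add_le_add_iff_right hfin).1 ?_
  calc _ ≤ ∫⁻ p, ‖p.1 - e p.2‖ₑ ^ 2 ∂γ +
        ENNReal.ofReal (t - 1) * ∫⁻ p, ‖p.1 - g p.2‖ₑ ^ 2 ∂γ := by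
        rw [ENNReal.ofReal_mul ht'.le]; gcongr
    _ ≤ ENNReal.ofReal t * ENNReal.ofReal ((t - 1) ^ 2 + ε / t) +
        ENNReal.ofReal (t * (t - 1)) := by rw [hid]; gcongr
    _ = ENNReal.ofReal ε + ENNReal.ofReal ((t - 1) * t ^ 2) := by
        rw [← ENNReal.ofReal_mul ht0.le, ← ENNReal.ofReal_add (by positivity) (by positivity),
          ← ENNReal.ofReal_add (by positivity) (by positivity)]
        congr 1
        field_simp
        ring

end GeodesicExtension

end BuresWasserstein

namespace BuresWasserstein

open Matrix

/-! ### The ray is Gaussian, with positive definite displacement matrices. -/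

section GaussianRay

variable {d : ℕ}

/-- The linear part at time `t` of the displacement interpolation with transport matrix `A`. -/
noncomputable def displacement (A : Matrix (Fin d) (Fin d) ℝ) (t : ℝ) : Matrix (Fin d) (Fin d) ℝ :=
  1 + t • (A - 1)

lemma transpose_displacement {A : Matrix (Fin d) (Fin d) ℝ} (hA : Aᵀ = A) (t : ℝ) :
    (displacement A t)ᵀ = displacement A t := by
  simp [displacement, transpose_add, transpose_smul, transpose_sub, hA]

lemma trace_one_sub_displacement (A S : Matrix (Fin d) (Fin d) ℝ) (t : ℝ) :
    ((1 - displacement A t) * (1 - displacement A t) * S).trace =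
      t ^ 2 * ((1 - A) * (1 - A) * S).trace := by
  have h : 1 - displacement A t = t • (1 - A) := by
    rw [displacement, smul_sub, smul_sub]; abel
  rw [h, smul_mul_smul_comm, smul_mul_assoc, trace_smul, smul_eq_mul, sq]

variable {m₀ m₁ : EuclideanSpace ℝ (Fin d)} {S₀ S₁ : Matrix (Fin d) (Fin d) ℝ}
  {μ : ℝ → Measure (EuclideanSpace ℝ (Fin d))}

/-- The squared distance of two nondegenerate Gaussian measures. -/
lemma W2_sq_multivariateGaussian (h₀ : S₀.PosDef) (h₁ : S₁.PosDef) :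
    W2 (multivariateGaussian m₀ S₀) (multivariateGaussian m₁ S₁) ^ 2 =
      ‖m₀ - m₁‖ ^ 2 + (S₀.trace + S₁.trace - 2 * (buresOT S₀ S₁ * S₀).trace) := by
  have h := W2_sq_affine (m := m₀) (c := m₁) h₀.posSemidef (posDef_buresOT h₀ h₁)
  rwa [buresOT_mul_mul_buresOT h₀ h₁.posSemidef] at h

/-- The upper bound needs only a symmetric map, so it applies to M S₀ M before this is known to be
nonsingular. -/
lemma W2_sq_multivariateGaussian_le (h₀ : S₀.PosDef) (h₁ : S₁.PosSemidef) :
    W2 (multivariateGaussian m₀ S₀) (multivariateGaussian m₁ S₁) ^ 2 ≤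
      ‖m₀ - m₁‖ ^ 2 + (S₀.trace + S₁.trace - 2 * (buresOT S₀ S₁ * S₀).trace) := by
  have h := W2_sq_affine_le (m := m₀) (c := m₁) h₀.posSemidef (transpose_buresOT S₀ S₁)
  rwa [buresOT_mul_mul_buresOT h₀ h₁] at h

/-- A unit speed geodesic ray through two nondegenerate Gaussian measures consists of Gaussian
measures after time one. -/
lemma geodesicRay_eq_multivariateGaussian (h₀ : S₀.PosDef) (h₁ : S₁.PosDef)
    (hμ : IsGeodesicRay μ) (hμ₀ : μ 0 = multivariateGaussian m₀ S₀)
    (hμ₁ : μ 1 = multivariateGaussian m₁ S₁) (hspeed : W2 (μ 0) (μ 1) = 1) {t : ℝ} (ht : 1 < t) :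
    μ t = multivariateGaussian (m₀ + t • (m₁ - m₀))
      (displacement (buresOT S₀ S₁) t * S₀ * displacement (buresOT S₀ S₁) t) := by
  have hA := posDef_buresOT h₀ h₁
  have hAT := transpose_buresOT S₀ S₁
  have hASA := buresOT_mul_mul_buresOT h₀ h₁.posSemidef
  set A := buresOT S₀ S₁
  have hu : IsUnit A.det := (isUnit_iff_isUnit_det _).1 hA.isUnit
  have hi : A⁻¹ * A = 1 := nonsing_inv_mul _ hu
  have hi' : A * A⁻¹ = 1 := mul_nonsing_inv _ hu
  have hAiT : (A⁻¹)ᵀ = A⁻¹ := by rw [transpose_nonsing_inv, hAT]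
  have hSA : A⁻¹ * S₁ * A⁻¹ = S₀ := by
    rw [← hASA, show A⁻¹ * (A * S₀ * A) * A⁻¹ = (A⁻¹ * A) * S₀ * (A * A⁻¹) by noncomm_ring, hi, hi',
      one_mul, mul_one]
  have hg : (multivariateGaussian m₁ S₁).map (affineMap m₁ m₀ A⁻¹) =
      multivariateGaussian m₀ S₀ := by
    rw [map_affineMap_multivariateGaussian h₁.posSemidef, hAiT, hSA]
  have hprob : IsProbabilityMeasure (μ t) := (hμ.mem_P2 t (by linarith)).1
  have hW1 : W2 (μ t) (multivariateGaussian m₁ S₁) = t - 1 := by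
    rw [← hμ₁, hμ.W2_eq 1 t zero_le_one (by linarith), hspeed, mul_one, abs_of_pos (by linarith)]
  have hW0 : W2 (μ t) ((multivariateGaussian m₁ S₁).map (affineMap m₁ m₀ A⁻¹)) = t := by
    rw [hg, ← hμ₀, hμ.W2_eq 0 t le_rfl (by linarith), hspeed, mul_one, sub_zero,
      abs_of_pos (by linarith)]
  have hcost : ∫⁻ x, ‖x - affineMap m₁ m₀ A⁻¹ x‖ₑ ^ 2 ∂(multivariateGaussian m₁ S₁) = 1 := by
    rw [lintegral_enorm_sub_affineMap_sq h₁.posSemidef hAiT,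
      ← W2_sq_affine h₁.posSemidef hA.inv, hSA, ← hμ₀, ← hμ₁, W2_comm, hspeed]
    simp
  rw [eq_map_extrapolation (measurable_affineMap m₁ m₀ A⁻¹) hcost ht hW1 hW0]
  -- The extrapolation is based at `μ 1`; composing with A on either side gives the displacement
  -- matrix based at `μ 0`.
  set Q := 1 + (t - 1) • (1 - A⁻¹) with hQ
  have hfun : (fun x => x + (t - 1) • (x - affineMap m₁ m₀ A⁻¹ x)) =
      affineMap m₁ (m₀ + t • (m₁ - m₀)) Q := by
    funext x
    rw [affineMap, affineMap, hQ, map_add, map_smul, map_sub (toEuclideanCLM (𝕜 := ℝ)) 1 A⁻¹,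
      map_one]
    simp only [_root_.add_apply, _root_.smul_apply, _root_.sub_apply, one_apply_eq_self]
    module
  have hQT : Qᵀ = Q := by
    simp [hQ, transpose_add, transpose_smul, transpose_sub, hAiT]
  have hQA : Q * A = displacement A t := by
    rw [hQ, displacement, add_mul, smul_mul_assoc, sub_mul, hi, one_mul]
    module
  have hAQ : A * Q = displacement A t := by
    rw [hQ, displacement, mul_add, mul_smul_comm, mul_sub, hi', mul_one]
    module
  rw [hfun, map_affineMap_multivariateGaussian h₁.posSemidef, hQT, ← hASA]
  congr 1
  calc Q * (A * S₀ * A) * Q = (Q * A) * S₀ * (A * Q) := by noncomm_ring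
    _ = _ := by rw [hQA, hAQ]

lemma norm_sub_add_smul_sq (m : EuclideanSpace ℝ (Fin d)) (t : ℝ) :
    ‖m - (m₀ + t • (m₁ - m₀))‖ ^ 2 =
      ‖m - m₀‖ ^ 2 - 2 * t * ⟪m₁ - m₀, m - m₀⟫ + t ^ 2 * ‖m₀ - m₁‖ ^ 2 := by
  rw [← sub_sub, norm_sub_sq_real, real_inner_smul_right, norm_smul, mul_pow, Real.norm_eq_abs,
    sq_abs, real_inner_comm (m₁ - m₀), norm_sub_rev m₁ m₀]
  ring

/-- The affine coupling with linear part M costs exactly t², which is also the squared distance. So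
the Bures coupling cannot be cheaper, and comparing the cross terms gives the hypothesis of
`posSemidef_of_trace_buresOT_le`. -/
lemma posSemidef_displacement (h₀ : S₀.PosDef) (h₁ : S₁.PosDef)
    (hμ : IsGeodesicRay μ) (hμ₀ : μ 0 = multivariateGaussian m₀ S₀)
    (hμ₁ : μ 1 = multivariateGaussian m₁ S₁) (hspeed : W2 (μ 0) (μ 1) = 1) {t : ℝ} (ht : 1 < t) :
    (displacement (buresOT S₀ S₁) t).PosSemidef := by
  have hμt := geodesicRay_eq_multivariateGaussian h₀ h₁ hμ hμ₀ hμ₁ hspeed ht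
  have hW1 := W2_sq_multivariateGaussian (m₀ := m₀) (m₁ := m₁) h₀ h₁
  have hAT := transpose_buresOT S₀ S₁
  have hASA := buresOT_mul_mul_buresOT h₀ h₁.posSemidef
  have htr := trace_one_sub_mul_self_mul (buresOT S₀ S₁) S₀
  rw [hASA] at htr
  rw [← htr, ← hμ₀, ← hμ₁, hspeed] at hW1
  set A := buresOT S₀ S₁
  have hMT := transpose_displacement hAT t
  have htrM := trace_one_sub_displacement A S₀ t
  rw [trace_one_sub_mul_self_mul] at htrM
  set M := displacement A t
  have hM : (M * S₀ * M).PosSemidef := by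
    simpa only [conjTranspose_eq_transpose_of_trivial, hMT] using
      h₀.posSemidef.mul_mul_conjTranspose_same M
  have hle := W2_sq_multivariateGaussian_le (m₀ := m₀) (m₁ := m₀ + t • (m₁ - m₀)) h₀ hM
  rw [← hμt, ← hμ₀, hμ.W2_eq t 0 (by linarith) le_rfl, hspeed, mul_one, sq_abs,
    norm_sub_add_smul_sq, sub_self, norm_zero, inner_zero_right] at hle
  refine posSemidef_of_trace_buresOT_le h₀ hMT ?_
  nlinarith [congrArg (fun r => t ^ 2 * r) hW1]

/-- The displacement is affine in t and is the identity at 0, so its value at t is the mean of the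
identity and the semidefinite value at 2t. -/
lemma posDef_displacement (h₀ : S₀.PosDef) (h₁ : S₁.PosDef)
    (hμ : IsGeodesicRay μ) (hμ₀ : μ 0 = multivariateGaussian m₀ S₀)
    (hμ₁ : μ 1 = multivariateGaussian m₁ S₁) (hspeed : W2 (μ 0) (μ 1) = 1) {t : ℝ} (ht : 1 < t) :
    (displacement (buresOT S₀ S₁) t).PosDef := by
  have h := posSemidef_displacement h₀ h₁ hμ hμ₀ hμ₁ hspeed (t := 2 * t) (by linarith)
  have h2 : displacement (buresOT S₀ S₁) t =
      (1 / 2 : ℝ) • (1 : Matrix (Fin d) (Fin d) ℝ) +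
        (1 / 2 : ℝ) • displacement (buresOT S₀ S₁) (2 * t) := by
    simp only [displacement]; module
  rw [h2]
  exact (PosDef.one.smul (by norm_num)).add_posSemidef (h.smul (by norm_num))

end GaussianRay

/-! ### A scalar limit. -/

section Limit

/-- If `f ≥ 0` and `f ^ 2 = t ^ 2 + 2 t b(t) + D` with `b → b₀`, then `f - t → b₀`. -/
lemma tendsto_sub_of_sq_eq {f b : ℝ → ℝ} {b₀ D : ℝ} (hf : ∀ t, 0 ≤ f t)
    (hb : Tendsto b atTop (𝓝 b₀)) (h : ∀ᶠ t in atTop, f t ^ 2 = t ^ 2 + 2 * t * b t + D) :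
    Tendsto (fun t => f t - t) atTop (𝓝 b₀) := by
  have hinv : Tendsto (fun t : ℝ => t⁻¹) atTop (𝓝 0) := tendsto_inv_atTop_zero
  have hr : Tendsto (fun t : ℝ => √(1 + 2 * (t⁻¹ * b t) + D * (t⁻¹) ^ 2)) atTop (𝓝 1) := by
    have := ((((hinv.mul hb).const_mul 2).const_add 1).add ((hinv.pow 2).const_mul D)).sqrt
    simpa using this
  -- This quotient is f - t = (f² - t²)/(f + t) with numerator and denominator divided by t.
  have hq : Tendsto (fun t : ℝ => (2 * b t + D * t⁻¹) /
      (√(1 + 2 * (t⁻¹ * b t) + D * (t⁻¹) ^ 2) + 1)) atTop (𝓝 b₀) := by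
    have := ((hb.const_mul 2).add (hinv.const_mul D)).div (hr.add_const 1) (by norm_num)
    rw [show (2 * b₀ + D * 0) / (1 + 1) = b₀ by ring] at this
    exact this
  refine hq.congr' ?_
  filter_upwards [h, eventually_gt_atTop 0] with t hsq ht
  have hft : √(1 + 2 * (t⁻¹ * b t) + D * (t⁻¹) ^ 2) = f t / t := by
    rw [show 1 + 2 * (t⁻¹ * b t) + D * (t⁻¹) ^ 2 = (f t / t) ^ 2 by
      rw [div_pow, hsq]; field_simp]
    exact Real.sqrt_sq (div_nonneg (hf t) ht.le)
  have hpos : 0 < f t + t := by linarith [hf t]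
  rw [hft, div_eq_iff (by have := hf t; positivity)]
  field_simp
  nlinarith

end Limit

end BuresWasserstein

namespace BuresWasserstein

open Matrix

/-! ### Covariance of the ray rescaled by t². -/

section AsymptoticCovariance

variable {d : ℕ}

/-- The asymptotic covariance of the ray seen from `S`, with parameter `s = 1 / t`. -/
noncomputable def rescaledCovariance (S S₀ B : Matrix (Fin d) (Fin d) ℝ) (s : ℝ) :
    Matrix (Fin d) (Fin d) ℝ :=
  msqrt S * ((s • 1 + B) * S₀ * (s • 1 + B)) * msqrt S

variable {S S₀ B : Matrix (Fin d) (Fin d) ℝ}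

lemma posSemidef_rescaledCovariance (h₀ : S₀.PosSemidef) (hB : Bᵀ = B) (s : ℝ) :
    (rescaledCovariance S S₀ B s).PosSemidef := by
  refine posSemidef_msqrt_mul_mul_msqrt ?_
  have hT : (s • 1 + B)ᵀ = s • 1 + B := by simp [transpose_add, transpose_smul, hB]
  have h := h₀.mul_mul_conjTranspose_same (s • 1 + B)
  rwa [conjTranspose_eq_transpose_of_trivial, hT] at h

lemma tendsto_trace_msqrt_rescaledCovariance (h₀ : S₀.PosSemidef) (hB : Bᵀ = B) :
    Tendsto (fun t : ℝ => (msqrt (rescaledCovariance S S₀ B t⁻¹)).trace) atTop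
      (𝓝 (msqrt (msqrt S * (B * S₀ * B) * msqrt S)).trace) := by
  have hG : Continuous (rescaledCovariance S S₀ B) := by
    unfold rescaledCovariance; fun_prop
  have hc : Continuous fun s => (msqrt (rescaledCovariance S S₀ B s)).trace :=
    (continuousOn_msqrt.comp_continuous hG
      fun s => posSemidef_rescaledCovariance h₀ hB s).matrix_trace
  have h0 : rescaledCovariance S S₀ B 0 = msqrt S * (B * S₀ * B) * msqrt S := by
    simp [rescaledCovariance]
  rw [← h0]
  exact (hc.tendsto 0).comp tendsto_inv_atTop_zero

lemma msqrt_conj_displacement {A : Matrix (Fin d) (Fin d) ℝ} (h₀ : S₀.PosSemidef) (hA : Aᵀ = A)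
    {t : ℝ} (ht : 0 < t) :
    msqrt (msqrt S * (displacement A t * S₀ * displacement A t) * msqrt S) =
      t • msqrt (rescaledCovariance S S₀ (A - 1) t⁻¹) := by
  have hB : (A - 1)ᵀ = A - 1 := by rw [transpose_sub, transpose_one, hA]
  rw [← msqrt_sq_smul (posSemidef_rescaledCovariance h₀ hB _) ht.le]
  congr 1
  have hD : displacement A t = t • (t⁻¹ • 1 + (A - 1)) := by
    rw [displacement, smul_add, smul_smul, mul_inv_cancel₀ ht.ne', one_smul]
  rw [hD, rescaledCovariance, sq, smul_mul_assoc, smul_mul_smul_comm, mul_smul_comm,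
    smul_mul_assoc]

lemma trace_displacement (A : Matrix (Fin d) (Fin d) ℝ) (t : ℝ) :
    (displacement A t * S₀ * displacement A t).trace =
      S₀.trace + 2 * t * (S₀ * (A - 1)).trace + t ^ 2 * ((1 - A) * (1 - A) * S₀).trace := by
  have h := trace_one_sub_mul_self_mul (displacement A t) S₀
  have h2 : (displacement A t * S₀).trace = S₀.trace + t * (S₀ * (A - 1)).trace := by
    rw [displacement, add_mul, one_mul, smul_mul_assoc, trace_add, trace_smul, trace_mul_comm,
      smul_eq_mul]
  rw [trace_one_sub_displacement, h2] at h
  linarith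

end AsymptoticCovariance

end BuresWasserstein

/-! ### The Busemann function at a Gaussian. -/

theorem proposition5 {d : ℕ}
    (m₀ m₁ m : EuclideanSpace ℝ (Fin d)) (S₀ S₁ S : Matrix (Fin d) (Fin d) ℝ)
    (hS₀ : S₀.PosDef) (hS₁ : S₁.PosDef) (hS : S.PosDef)
    (μ : ℝ → Measure (EuclideanSpace ℝ (Fin d)))
    (hμ : IsGeodesicRay μ)
    (hμ₀ : μ 0 = multivariateGaussian m₀ S₀) (hμ₁ : μ 1 = multivariateGaussian m₁ S₁)
    (hspeed : W2 (μ 0) (μ 1) = 1) :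
    HasBusemannValue μ (multivariateGaussian m S)
      (-⟪m₁ - m₀, m - m₀⟫
        + (S₀ * (buresOT S₀ S₁ - 1)).trace
        - (msqrt
            (msqrt S *
              (S₀ - S₀ * buresOT S₀ S₁
                - buresOT S₀ S₁ * S₀ + S₁) *
              msqrt S)).trace) := by
  have hAT := transpose_buresOT S₀ S₁
  have hASA := buresOT_mul_mul_buresOT hS₀ hS₁.posSemidef
  have hspeed' := W2_sq_multivariateGaussian (m₀ := m₀) (m₁ := m₁) hS₀ hS₁
  have htr := trace_one_sub_mul_self_mul (buresOT S₀ S₁) S₀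
  rw [hASA] at htr
  rw [← htr, ← hμ₀, ← hμ₁, hspeed, one_pow] at hspeed'
  have hpos : ∀ t : ℝ, 1 < t → (displacement (buresOT S₀ S₁) t).PosDef :=
    fun t ht => posDef_displacement hS₀ hS₁ hμ hμ₀ hμ₁ hspeed ht
  have hray : ∀ t : ℝ, 1 < t → _ :=
    fun t ht => geodesicRay_eq_multivariateGaussian hS₀ hS₁ hμ hμ₀ hμ₁ hspeed ht
  rw [show S₀ - S₀ * buresOT S₀ S₁ - buresOT S₀ S₁ * S₀ + S₁ =
    (buresOT S₀ S₁ - 1) * S₀ * (buresOT S₀ S₁ - 1) by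
      -- The third occurrence is the free-standing S₁; the first two lie inside `buresOT S₀ S₁`.
      nth_rewrite 3 [← hASA]
      noncomm_ring]
  set A := buresOT S₀ S₁
  have hB : (A - 1).transpose = A - 1 := by rw [Matrix.transpose_sub, Matrix.transpose_one, hAT]
  have hlim := tendsto_trace_msqrt_rescaledCovariance (S := S) hS₀.posSemidef hB
  simp only [HasBusemannValue, hspeed, one_mul]
  refine tendsto_sub_of_sq_eq (D := ‖m - m₀‖ ^ 2 + S.trace + S₀.trace)
    (fun t => W2_nonneg _ _) (hlim.const_sub _) ?_
  filter_upwards [eventually_gt_atTop 1] with t ht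
  have hMT := transpose_displacement hAT t
  have hMS : (displacement A t * S₀ * displacement A t).PosDef := by
    have hsemi : (displacement A t * S₀ * displacement A t).PosSemidef := by
      simpa only [Matrix.conjTranspose_eq_transpose_of_trivial, hMT] using
        hS₀.posSemidef.mul_mul_conjTranspose_same (displacement A t)
    exact hsemi.posDef_iff_isUnit.2 (((hpos t ht).isUnit.mul hS₀.isUnit).mul (hpos t ht).isUnit)
  -- The distance is taken from ν, so that the cross term is conjugated by the fixed S^{1/2} and a
  -- factor t can be pulled out of the root.
  rw [hray t ht, W2_comm, W2_sq_multivariateGaussian hS hMS, trace_buresOT_mul hS,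
    msqrt_conj_displacement hS₀.posSemidef hAT (by linarith), Matrix.trace_smul, smul_eq_mul,
    trace_displacement, norm_sub_add_smul_sq]
  -- Unit speed says that ‖m₀ - m₁‖² + tr((1 - A)²S₀), the coefficient of t², equals one.
  linear_combination (-t ^ 2) * hspeed'
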